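/- Let $q$ be a prime power, let $k\ge 3$ and $\ell\ge 0$ be integers, and let $\phi$ be Euler's function. A word $w=(w_1,\dots,w_n)$ is a $(b,m)$-constrained de Bruijn sequence if $(w_i,\dots,w_{i+m-1})\ne(w_j,\dots,w_{j+m-1})$ for all $i,j\in\{1,\dots,n-m+1\}$ with $0<|i-j|\le b-1$. An m-sequence of order $k$ over $\mathbb F_q$ is a cyclic sequence $[u_0,\dots,u_{q^k-2}]$ (words that differ by a cyclic shift are identified) consisting of the first $q^k-1$ terms of a nonzero solution of a linear recurrence $u_{n+k}=\sum_{i=1}^k c_iu_{n+k-i}$ $(n\ge 0)$ whose characteristic polynomial $c(x)=1-\sum_{i=1}^kc_ix^i\in\mathbb F_q[x]$ is a primitive polynomial of degree $k$, that is, $c$ is irreducible of degree $k$ and its roots have multiplicative order $q^k-1$. Every m-sequence of order $k$ can be written as an acyclic word of length $q^k-1$ that ends with $k-1$ zeros. Fix for each m-sequence of order $k$ one such word, and let $\mathcal S$ be the set of these words. Let $$\mathbb C=\{\,s_1 0^{\epsilon_1}s_2 0^{\epsilon_2}\cdots s_\ell 0^{\epsilon_\ell}\;:\; s_i\in\mathcal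 S,\ 0\le\epsilon_i\le k+1,\ 1\le i\le \ell\,\}.$$ Then, for every such choice of words, each element of $\mathbb C$ is a $(q^k-1,2k)$-constrained de Bruijn sequence of length at least $\ell(q^k-1)$ and at most $\ell(q^k+k)$, and $$|\mathbb C|=M^\ell,\qquad M=\frac{\phi(q^k-1)\,(k+2)}{k}.$$ -/

import Mathlib

namespace ConstrainedDeBruijn

/-- The word `w` is a `(b, k)`-constrained de Bruijn sequence: two windows of length `k` of `w`
that start at distinct positions at distance at most `b - 1` are different
(positions are counted from `0`, and the smaller one is called `i`). -/
def IsConstrainedDeBruijn {α : Type*} (b k : ℕ) (w : List α) : Prop :=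
  ∀ i j : ℕ, i < j → j < i + b → j + k ≤ w.length →
    (w.drop i).take k ≠ (w.drop j).take k

variable {F : Type*} [Field F]

/-- A polynomial over a finite field with `q` elements is primitive if it is irreducible, of
degree `d` say, and its root generates the multiplicative group (of order `q ^ d - 1`) of the
extension of degree `d`. -/
def IsPrimitivePoly [Fintype F] (p : Polynomial F) : Prop :=
  Irreducible p ∧ orderOf (AdjoinRoot.root p) = Fintype.card F ^ p.natDegree - 1

/-- The linear feedback shift register of order `k` with characteristic polynomial
`c = 1 - ∑_{i=1}^k c_i x^i`, i.e. the recurrence `u (n + k) = ∑_{i=1}^k c_i u (n + k - i)`;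
here `c_i = - c.coeff i`, and the coefficient of `u (n + j)` is `c_{k - j}`. -/
def lfsr (k : ℕ) (c : Polynomial F) : LinearRecurrence F where
  order := k
  coeffs := fun j => -c.coeff (k - (j : ℕ))

/-- The set of m-sequences of order `k` over `F`. They are cyclic sequences (words up to cyclic
shift) of length `q ^ k - 1`, generated from a nonzero initial state by a linear feedback shift
register whose characteristic polynomial (with constant term `1`) is primitive of degree `k`. -/
def mSequences (F : Type*) [Field F] [Fintype F] (k : ℕ) : Set (Cycle F) :=
  {s | ∃ (c : Polynomial F) (u : ℕ → F),
    IsPrimitivePoly c ∧ c.natDegree = k ∧ c.coeff 0 = 1 ∧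
    (lfsr k c).IsSolution u ∧ u ≠ 0 ∧
    s = ((List.ofFn fun i : Fin (Fintype.card F ^ k - 1) => u i : List F) : Cycle F)}

/-- `r` writes each m-sequence of order `k` as an acyclic word, by cutting the cyclic sequence
right after a run of `k - 1` zeros. -/
def IsZeroAligned [Fintype F] (k : ℕ) (r : Cycle F → List F) : Prop :=
  ∀ s ∈ mSequences F k, (r s : Cycle F) = s ∧ List.replicate (k - 1) (0 : F) <:+ r s

/-- The code of all words `s_1 0^{ε_1} s_2 0^{ε_2} ⋯ s_ℓ 0^{ε_ℓ}`, where each `s_i` is an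
m-sequence of order `k`, written as an acyclic word by `r`, and `0 ≤ ε_i ≤ k + 1`. -/
def code [Fintype F] (k ℓ : ℕ) (r : Cycle F → List F) : Set (List F) :=
  {w | ∃ (s : Fin ℓ → Cycle F) (ε : Fin ℓ → ℕ),
    (∀ i, s i ∈ mSequences F k) ∧ (∀ i, ε i ≤ k + 1) ∧
    w = (List.ofFn fun i => r (s i) ++ List.replicate (ε i) (0 : F)).flatten}

end ConstrainedDeBruijn

/-! Put `N = q ^ k - 1`. If `β` is the inverse of a root of a primitive feedback polynomial `c`, the
nonzero solutions of the recurrence are the sequences `φ (β ^ n)`, with `φ` a nonzero linear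
functional on the field with `q ^ k` elements. Hence windows of length `k` never vanish and repeat
only modulo `N`, a run of `k - 1` zeros occurs, all nonzero solutions are shifts of one another, and
`2 * k` terms determine `c` (`feedbackPoly_unique`). So m-sequences correspond to feedback
polynomials, that is, to generators of the multiplicative group up to conjugacy; each class has `k`
elements (`mul_ncard_feedbackPoly`).

Each block ends with `k - 1` zeros, so a stretch overlapping the start of a block still reads like
its cyclic sequence. `IsConcatenation.exists_window_ne` compares two windows of length `2 * k` less
than `N` apart. Within one block `k` letters suffice. Across two blocks, either the polynomials,
hence the words, agree, or some `k` letters of the windows reduce to one block or set zeros against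
a nonvanishing window. Two windows starting in the same gap are told apart by the end of the zero
run, which is visible because `ε ≤ k + 1`.

For the count, blocks have length `N` and start with a nonzero letter, so a codeword determines all
`s_i` and `ε_i` (`flatten_blocks_injective`). -/

namespace ConstrainedDeBruijn

open Polynomial Module

universe u

/-- `c` is a primitive polynomial of degree `k` with constant coefficient `1`. -/
def IsFeedbackPoly {F : Type*} [Field F] [Fintype F] (k : ℕ) (c : F[X]) : Prop :=
  IsPrimitivePoly c ∧ c.natDegree = k ∧ c.coeff 0 = 1

/-! ### Linear functionals on an extension of degree `k`. -/

section Functional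

variable {F K : Type*} [Field F] [Field K] [Algebra F K] {k : ℕ} {β : K}
  {b : Basis (Fin k) F K} {φ : K →ₗ[F] F}

/-- A nonzero functional that vanishes on `x * β ^ i` for all basis elements `β ^ i` forces
`x = 0`. -/
theorem eq_zero_of_functional_mul_pow (hb : ∀ i, b i = β ^ (i : ℕ)) (hφ : φ ≠ 0) {x : K}
    (h : ∀ i < k, φ (x * β ^ i) = 0) : x = 0 := by
  by_contra hx
  apply hφ
  have h1 : φ ∘ₗ LinearMap.mulLeft F x = 0 :=
    b.ext fun i => by simpa [hb] using h i i.2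
  ext z
  have := LinearMap.congr_fun h1 (x⁻¹ * z)
  simpa [mul_inv_cancel_left₀ hx] using this

/-- These are `k - 1` linear conditions on a space of dimension `k`. -/
theorem exists_ne_zero_functional_mul_pow (b : Basis (Fin k) F K) (hk : 0 < k) (φ : K →ₗ[F] F) (β : K) :
    ∃ x : K, x ≠ 0 ∧ ∀ i < k - 1, φ (x * β ^ i) = 0 := by
  let T : K →ₗ[F] (Fin (k - 1) → F) :=
    LinearMap.pi fun i => φ ∘ₗ LinearMap.mulRight F (β ^ (i : ℕ))
  have : FiniteDimensional F K := b.finiteDimensional_of_finite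
  have hdim : finrank F (Fin (k - 1) → F) < finrank F K := by
    rw [finrank_eq_card_basis b]; simp; omega
  obtain ⟨x, hx, hx0⟩ := Submodule.exists_mem_ne_zero_of_ne_bot
    (LinearMap.ker_ne_bot_of_finrank_lt hdim (f := T))
  refine ⟨x, hx0, fun i hi => ?_⟩
  simpa [T] using congr_fun (LinearMap.mem_ker.1 hx) ⟨i, hi⟩

/-- The map from `y` to the functional `φ (y * ·)` is injective into the dual space, which has the
same dimension. -/
theorem exists_functional_mul (b : Basis (Fin k) F K) (hφ : φ ≠ 0) (ψ : K →ₗ[F] F) :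
    ∃ y : K, ∀ z, ψ z = φ (y * z) := by
  have : FiniteDimensional F K := b.finiteDimensional_of_finite
  let T : K →ₗ[F] (K →ₗ[F] F) :=
    { toFun := fun y => φ ∘ₗ LinearMap.mulLeft F y
      map_add' := fun x y => by ext z; simp [add_mul]
      map_smul' := fun a x => by ext z; simp }
  have hT : Function.Injective T := by
    rw [injective_iff_map_eq_zero]
    intro y hy
    by_contra hy0
    apply hφ
    ext z
    have := LinearMap.congr_fun hy (y⁻¹ * z)
    simpa [T, mul_inv_cancel_left₀ hy0] using this
  have hs : Function.Surjective T :=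
    (LinearMap.injective_iff_surjective_of_finrank_eq_finrank
      (Subspace.dual_finrank_eq (K := F) (V := K)).symm).1 hT
  obtain ⟨y, hy⟩ := hs ψ
  exact ⟨y, fun z => by rw [← hy]; rfl⟩

end Functional

/-! ### Shift-register sequences as functionals of powers. -/

section Recurrence

variable {F : Type*} [Field F] {k : ℕ} {c : F[X]} {v : ℕ → F}

theorem isSolution_lfsr_iff : (lfsr k c).IsSolution v ↔
    ∀ n, v (n + k) = ∑ i : Fin k, -c.coeff (k - (i : ℕ)) * v (n + i) :=
  Iff.rfl

theorem lfsr_isSolution_shift (hv : (lfsr k c).IsSolution v) (m : ℕ) :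
    (lfsr k c).IsSolution fun n => v (n + m) := by
  rw [isSolution_lfsr_iff] at hv ⊢
  intro n
  simpa only [add_right_comm _ m] using hv (n + m)

theorem lfsr_isSolution_functional {K : Type*} [Field K] [Algebra F K] {β : K}
    (hβ : β ^ k = ∑ i : Fin k, (-c.coeff (k - (i : ℕ))) • β ^ (i : ℕ)) (φ : K →ₗ[F] F) :
    (lfsr k c).IsSolution fun n => φ (β ^ n) := by
  rw [isSolution_lfsr_iff]
  intro n
  rw [pow_add, hβ, Finset.mul_sum, map_sum]
  refine Finset.sum_congr rfl fun i _ => ?_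
  rw [mul_smul_comm, map_smul, smul_eq_mul, pow_add]

theorem exists_functional_of_isSolution {K : Type*} [Field K] [Algebra F K] {β : K}
    {b : Basis (Fin k) F K} (hb : ∀ i, b i = β ^ (i : ℕ))
    (hβ : β ^ k = ∑ i : Fin k, (-c.coeff (k - (i : ℕ))) • β ^ (i : ℕ))
    (hv : (lfsr k c).IsSolution v) (hv0 : v ≠ 0) :
    ∃ φ : K →ₗ[F] F, φ ≠ 0 ∧ ∀ n, v n = φ (β ^ n) := by
  let φ : K →ₗ[F] F := b.constr F fun i => v i
  have h : ∀ n, v n = φ (β ^ n) := by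
    have h3 : ∀ i : Fin k, φ (β ^ (i : ℕ)) = v i := fun i => by
      rw [← hb]
      exact b.constr_basis F _ _
    have h1 := (lfsr k c).eq_mk_of_is_sol_of_eq_init (init := fun i => v i) hv fun _ => rfl
    have h2 := (lfsr k c).eq_mk_of_is_sol_of_eq_init (init := fun i => v i)
      (lfsr_isSolution_functional hβ φ) h3
    exact fun n => (h1 n).trans (h2 n).symm
  refine ⟨φ, fun h0 => hv0 ?_, h⟩
  ext n
  rw [h, h0]
  rfl

theorem lfsr_exists_solution (hk : 0 < k) (c : F[X]) :
    ∃ v, (lfsr k c).IsSolution v ∧ v ≠ 0 := by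
  refine ⟨_, (lfsr k c).is_sol_mkSol fun _ => 1, fun h => ?_⟩
  have h1 := (lfsr k c).mkSol_eq_init (fun _ => 1) ⟨0, hk⟩
  rw [h] at h1
  exact zero_ne_one h1

end Recurrence

variable {F : Type u} [Field F] [Fintype F] {k : ℕ} {c : F[X]} {v : ℕ → F}

theorem exists_pow_eq_of_orderOf {K : Type*} [Field K] [Fintype K] {β x : K} (hx : x ≠ 0)
    (hβ : orderOf β = Fintype.card K - 1) : ∃ m, β ^ m = x := by
  have h2 : 1 < Fintype.card K := Fintype.one_lt_card
  have : NeZero (Fintype.card K - 1) := ⟨by omega⟩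
  have hprim : IsPrimitiveRoot β (Fintype.card K - 1) := hβ ▸ IsPrimitiveRoot.orderOf β
  obtain ⟨m, -, hm⟩ := hprim.eq_pow_of_pow_eq_one (FiniteField.pow_card_sub_one_eq_one x hx)
  exact ⟨m, hm⟩

/-- The sequences generated by a primitive shift register are the images under linear functionals
of the powers of a generator `β` of the field with `q ^ k` elements. -/
theorem exists_field_of_feedbackPoly (hc : IsFeedbackPoly k c) :
    ∃ (K : Type u) (_ : Field K) (_ : Algebra F K) (β : K) (b : Basis (Fin k) F K),
      (∀ i, b i = β ^ (i : ℕ)) ∧ β ≠ 0 ∧ orderOf β = Fintype.card F ^ k - 1 ∧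
      (∀ x : K, x ≠ 0 → ∃ m, β ^ m = x) ∧
      β ^ k = ∑ i : Fin k, (-c.coeff (k - (i : ℕ))) • β ^ (i : ℕ) := by
  obtain ⟨⟨hirr, hord⟩, hdeg, h0⟩ := hc
  have := Fact.mk hirr
  let α := AdjoinRoot.root c
  have hα : α ≠ 0 := by
    intro h
    have : aeval α c = 0 := by rw [AdjoinRoot.aeval_eq, AdjoinRoot.mk_self]
    rw [h, aeval_def, eval₂_at_zero, h0] at this
    simp at this
  let β := α⁻¹
  let pb := AdjoinRoot.powerBasis hirr.ne_zero
  have hpb : pb.dim = k := hdeg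
  let b0 : Basis (Fin k) F (AdjoinRoot c) := pb.basis.reindex (finCongr hpb)
  have hb0 : ∀ i, b0 i = α ^ (i : ℕ) := fun i => by
    simp [b0, pb, α, AdjoinRoot.powerBasis_gen]
  -- Multiplication by `β ^ (k - 1)` turns the basis `α ^ i` into `β ^ (k - 1 - i)`; reversing the
  -- order gives the powers of `β`.
  let e : AdjoinRoot c ≃ₗ[F] AdjoinRoot c :=
    LinearEquiv.ofBijective (LinearMap.mulLeft F (β ^ (k - 1)))
      (mulLeft_bijective₀ _ (pow_ne_zero _ (inv_ne_zero hα)))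
  let b : Basis (Fin k) F (AdjoinRoot c) := (b0.map e).reindex Fin.revPerm
  have hb : ∀ i, b i = β ^ (i : ℕ) := fun i => by
    have h1 : b i = β ^ (k - 1) * α ^ (k - ((i : ℕ) + 1)) := by
      simp only [b, Basis.reindex_apply, Basis.map_apply, hb0, Fin.revPerm_symm,
        Fin.revPerm_apply, Fin.val_rev]
      rfl
    rw [h1]
    have : k - 1 = i + (k - (i + 1)) := by have := i.2; omega
    rw [this, pow_add, mul_assoc]
    simp only [β, inv_pow]
    rw [inv_mul_cancel₀ (pow_ne_zero _ hα), mul_one]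
  have hβ : orderOf β = Fintype.card F ^ k - 1 := by
    rw [← hdeg, ← hord]
    simp only [β]
    rw [← Units.val_mk0 hα, ← Units.val_inv_eq_inv_val, orderOf_units, orderOf_inv, ← orderOf_units]
    rfl
  refine ⟨AdjoinRoot c, inferInstance, inferInstance, β, b, hb, inv_ne_zero hα, hβ, fun x hx => ?_, ?_⟩
  · have : FiniteDimensional F (AdjoinRoot c) := b.finiteDimensional_of_finite
    have : Finite (AdjoinRoot c) := Module.finite_of_finite F
    let := Fintype.ofFinite (AdjoinRoot c)
    apply exists_pow_eq_of_orderOf hx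
    rw [hβ, Module.card_eq_pow_finrank (K := F) (V := AdjoinRoot c), finrank_eq_card_basis b, Fintype.card_fin]
  · have h1 : aeval α c = 0 := by rw [AdjoinRoot.aeval_eq, AdjoinRoot.mk_self]
    rw [aeval_eq_sum_range, hdeg, Finset.sum_range_succ', h0] at h1
    have h2 : ∀ j ≤ k, β ^ k * α ^ j = β ^ (k - j) := fun j hj => by
      obtain ⟨d, rfl⟩ := Nat.exists_eq_add_of_le' hj
      simp only [β, inv_pow, Nat.add_sub_cancel]
      rw [pow_add, mul_inv, mul_assoc, inv_mul_cancel₀ (pow_ne_zero _ hα), mul_one]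
    -- Multiplying `c(α) = 0` by `β ^ k` reverses the coefficients, which gives the recurrence for
    -- `β`.
    have h3 := congr_arg (β ^ k * ·) h1
    simp only [mul_add, mul_zero, Finset.mul_sum, pow_zero, one_smul, mul_one, mul_smul_comm] at h3
    rw [← Fin.sum_univ_eq_sum_range (fun j => c.coeff (j + 1) • (β ^ k * α ^ (j + 1)))] at h3
    rw [eq_neg_of_add_eq_zero_right h3, ← Finset.sum_neg_distrib, ← Equiv.sum_comp Fin.revPerm]
    refine Finset.sum_congr rfl fun i _ => ?_
    have := i.2
    rw [h2 _ (by omega), Fin.revPerm_apply, Fin.val_rev, neg_smul]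
    congr 3 <;> omega

theorem solution_periodic (hc : IsFeedbackPoly k c) (hv : (lfsr k c).IsSolution v)
    (hv0 : v ≠ 0) (n : ℕ) : v (n + (Fintype.card F ^ k - 1)) = v n := by
  obtain ⟨K, _, _, β, b, hb, hβ0, hord, hgen, hrec⟩ := exists_field_of_feedbackPoly hc
  obtain ⟨φ, hφ, h⟩ := exists_functional_of_isSolution hb hrec hv hv0
  rw [h, h, pow_add, ← hord, pow_orderOf_eq_one, mul_one]

theorem solution_window_injective (hc : IsFeedbackPoly k c) (hv : (lfsr k c).IsSolution v)
    (hv0 : v ≠ 0) {m n : ℕ} (h : ∀ i < k, v (m + i) = v (n + i)) :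
    m ≡ n [MOD Fintype.card F ^ k - 1] := by
  obtain ⟨K, _, _, β, b, hb, hβ0, hord, hgen, hrec⟩ := exists_field_of_feedbackPoly hc
  obtain ⟨φ, hφ, hvφ⟩ := exists_functional_of_isSolution hb hrec hv hv0
  have h1 : β ^ m - β ^ n = 0 := eq_zero_of_functional_mul_pow hb hφ fun i hi => by
    rw [sub_mul, ← pow_add, ← pow_add, map_sub, ← hvφ, ← hvφ, h i hi, sub_self]
  have h2 : Units.mk0 β hβ0 ^ m = Units.mk0 β hβ0 ^ n := by
    ext
    simpa using sub_eq_zero.1 h1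
  rw [pow_eq_pow_iff_modEq, ← orderOf_units, Units.val_mk0, hord] at h2
  exact h2

theorem solution_window_ne_zero (hc : IsFeedbackPoly k c) (hv : (lfsr k c).IsSolution v)
    (hv0 : v ≠ 0) (m : ℕ) : ∃ i < k, v (m + i) ≠ 0 := by
  obtain ⟨K, _, _, β, b, hb, hβ0, hord, hgen, hrec⟩ := exists_field_of_feedbackPoly hc
  obtain ⟨φ, hφ, hvφ⟩ := exists_functional_of_isSolution hb hrec hv hv0
  by_contra! h
  have h1 : β ^ m = 0 := eq_zero_of_functional_mul_pow hb hφ fun i hi => by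
    rw [← pow_add, ← hvφ, h i hi]
  exact pow_ne_zero m hβ0 h1

theorem solution_exists_zero_run (hc : IsFeedbackPoly k c) (hv : (lfsr k c).IsSolution v)
    (hv0 : v ≠ 0) (hk : 0 < k) : ∃ m, ∀ i < k - 1, v (m + i) = 0 := by
  obtain ⟨K, _, _, β, b, hb, hβ0, hord, hgen, hrec⟩ := exists_field_of_feedbackPoly hc
  obtain ⟨φ, hφ, hvφ⟩ := exists_functional_of_isSolution hb hrec hv hv0
  obtain ⟨x, hx, h⟩ := exists_ne_zero_functional_mul_pow b hk φ β
  obtain ⟨m, rfl⟩ := hgen x hx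
  exact ⟨m, fun i hi => by rw [hvφ, pow_add, h i hi]⟩

theorem solution_unique_up_to_shift (hc : IsFeedbackPoly k c) (hv : (lfsr k c).IsSolution v)
    (hv0 : v ≠ 0) {u : ℕ → F} (hu : (lfsr k c).IsSolution u) (hu0 : u ≠ 0) :
    ∃ m, ∀ n, u n = v (n + m) := by
  obtain ⟨K, _, _, β, b, hb, hβ0, hord, hgen, hrec⟩ := exists_field_of_feedbackPoly hc
  obtain ⟨φ, hφ, hvφ⟩ := exists_functional_of_isSolution hb hrec hv hv0
  obtain ⟨ψ, hψ, huψ⟩ := exists_functional_of_isSolution hb hrec hu hu0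
  obtain ⟨y, hy⟩ := exists_functional_mul b hφ ψ
  obtain ⟨m, rfl⟩ := hgen y (by
    rintro rfl
    exact hψ (by ext z; simp [hy z]))
  exact ⟨m, fun n => by rw [huψ, hy, hvφ, add_comm, pow_add]⟩

/-- Any `2 * k` consecutive terms of a nonzero solution determine the feedback polynomial. -/
theorem feedbackPoly_unique (hc : IsFeedbackPoly k c) (hv : (lfsr k c).IsSolution v)
    (hv0 : v ≠ 0) {c' : F[X]} {u : ℕ → F} (hc' : IsFeedbackPoly k c')
    (hu : (lfsr k c').IsSolution u) {m n : ℕ} (h : ∀ i < 2 * k, v (m + i) = u (n + i)) :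
    c = c' := by
  obtain ⟨K, _, _, β, b, hb, hβ0, hord, hgen, hrec⟩ := exists_field_of_feedbackPoly hc
  obtain ⟨φ, hφ, hvφ⟩ := exists_functional_of_isSolution hb hrec hv hv0
  rw [isSolution_lfsr_iff] at hv hu
  -- Both recurrences compute the same next term from the same `k` terms, for `k` successive
  -- positions. Their difference says that `φ` kills `β ^ m * z * β ^ j` for all `j < k`, so `z =
  -- 0`.
  let z : K := ∑ i : Fin k, (c.coeff (k - (i : ℕ)) - c'.coeff (k - (i : ℕ))) • β ^ (i : ℕ)
  have hz : β ^ m * z = 0 := eq_zero_of_functional_mul_pow hb hφ fun j hj => by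
    have h1 : φ (β ^ m * z * β ^ j) = ∑ i : Fin k,
        (c.coeff (k - (i : ℕ)) - c'.coeff (k - (i : ℕ))) * v (m + j + i) := by
      simp only [z, Finset.mul_sum, Finset.sum_mul, map_sum]
      refine Finset.sum_congr rfl fun i _ => ?_
      rw [mul_smul_comm, smul_mul_assoc, map_smul, hvφ, smul_eq_mul]
      congr 2
      ring
    have h2 := hv (m + j)
    have h3 := hu (n + j)
    rw [add_assoc, h (j + k) (by omega), ← add_assoc, h3] at h2
    rw [h1]
    simp only [sub_mul, Finset.sum_sub_distrib]
    have h4 : ∑ i : Fin k, -c'.coeff (k - (i : ℕ)) * u (n + j + i) =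
        ∑ i : Fin k, -c'.coeff (k - (i : ℕ)) * v (m + j + i) :=
      Finset.sum_congr rfl fun i _ => by
        rw [add_assoc n, add_assoc m, h (j + i) (by omega)]
    rw [h4] at h2
    simp only [neg_mul, Finset.sum_neg_distrib, neg_inj] at h2
    rw [h2, sub_self]
  have hz0 : z = 0 := (mul_eq_zero.1 hz).resolve_left (pow_ne_zero m hβ0)
  have hcoeff := Fintype.linearIndependent_iff.1 b.linearIndependent
    (fun i => c.coeff (k - (i : ℕ)) - c'.coeff (k - (i : ℕ))) (by simpa only [hb] using hz0)
  ext j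
  rcases Nat.eq_zero_or_pos j with rfl | hj
  · rw [hc.2.2, hc'.2.2]
  rcases le_or_gt j k with hjk | hjk
  · have := hcoeff ⟨k - j, by omega⟩
    simp only [Nat.sub_sub_self hjk] at this
    exact sub_eq_zero.1 this
  · rw [coeff_eq_zero_of_natDegree_lt (hc.2.1.trans_lt hjk),
      coeff_eq_zero_of_natDegree_lt (hc'.2.1.trans_lt hjk)]

end ConstrainedDeBruijn

/-! ### Counting primitive polynomials. -/

namespace ConstrainedDeBruijn

open Polynomial Module

theorem exists_extension (F : Type*) [Field F] [Fintype F] {k : ℕ} (hk : 0 < k) :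
    ∃ (K : Type) (_ : Field K) (_ : Fintype K) (_ : Algebra F K),
      finrank F K = k := by
  have : NeZero k := ⟨hk.ne'⟩
  obtain ⟨p, hp⟩ := CharP.exists F
  have : Fact p.Prime := ⟨CharP.char_is_prime F p⟩
  exact ⟨FiniteField.Extension F p k, inferInstance, Fintype.ofFinite _, inferInstance,
    FiniteField.finrank_extension F p k⟩

/-- The scalar multiple with constant coefficient `1` of the minimal polynomial. -/
noncomputable def unitMinpoly (F : Type*) {K : Type*} [Field F] [Field K] [Algebra F K] (x : K) :
    F[X] :=
  C ((minpoly F x).coeff 0)⁻¹ * minpoly F x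

section

variable {F K : Type*} [Field F] [Field K] [Algebra F K]

theorem orderOf_root_of_aeval_eq_zero {c : F[X]} (hc : Irreducible c) {x : K}
    (hx : aeval x c = 0) : orderOf x = orderOf (AdjoinRoot.root c) := by
  have := Fact.mk hc
  let f : AdjoinRoot c →ₐ[F] K := AdjoinRoot.liftAlgHom c (Algebra.ofId F K) x hx
  have hf : f (AdjoinRoot.root c) = x := AdjoinRoot.liftAlgHom_root ..
  conv_lhs => rw [← hf]
  exact orderOf_injective (f : AdjoinRoot c →* K) f.injective _

theorem unitMinpoly_eq_iff {c : F[X]} (hc : Irreducible c) (h1 : c.coeff 0 = 1) {x : K} :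
    unitMinpoly F x = c ↔ aeval x c = 0 := by
  constructor
  · rintro rfl
    simp [unitMinpoly]
  · intro h
    obtain ⟨d, hd⟩ := minpoly.dvd F x h
    have hunit := (hc.isUnit_or_isUnit hd).resolve_left (minpoly.not_isUnit F x)
    obtain ⟨a, ha, rfl⟩ := isUnit_iff.1 hunit
    rw [hd, coeff_mul_C] at h1
    rw [unitMinpoly, hd, inv_eq_of_mul_eq_one_right h1, mul_comm]

end

section

variable {F K : Type*} [Field F] [Fintype F] [Field K] [Fintype K] [Algebra F K]

theorem unitMinpoly_isFeedbackPoly {x : K} (hx : x ≠ 0)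
    (hord : orderOf x = Fintype.card K - 1) :
    IsFeedbackPoly (finrank F K) (unitMinpoly F x) := by
  have hint : IsIntegral F x := Algebra.IsIntegral.isIntegral x
  have h0 : (minpoly F x).coeff 0 ≠ 0 := minpoly.coeff_zero_ne_zero hint hx
  have hirr : Irreducible (unitMinpoly F x) :=
    (irreducible_isUnit_mul (isUnit_C.2 (inv_ne_zero h0).isUnit)).2 (minpoly.irreducible hint)
  have htop : IntermediateField.adjoin F {x} = ⊤ := by
    rw [eq_top_iff]
    intro y _
    rcases eq_or_ne y 0 with rfl | hy
    · exact zero_mem _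
    · obtain ⟨m, rfl⟩ := exists_pow_eq_of_orderOf hy hord
      exact pow_mem (IntermediateField.mem_adjoin_simple_self F x) m
  have hdeg : (unitMinpoly F x).natDegree = finrank F K := by
    rw [unitMinpoly, natDegree_C_mul (inv_ne_zero h0), ← IntermediateField.adjoin.finrank hint,
      htop, IntermediateField.finrank_top']
  refine ⟨⟨hirr, ?_⟩, hdeg, ?_⟩
  · rw [← orderOf_root_of_aeval_eq_zero hirr (x := x) (by simp [unitMinpoly]), hord, hdeg,
      Module.card_eq_pow_finrank (K := F) (V := K)]
  · rw [unitMinpoly, coeff_C_mul, inv_mul_cancel₀ h0]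

/-- Finite fields are perfect, so `c` is separable. It has a root in `K` because `AdjoinRoot c`
embeds there, and it splits because `K` is normal over `F`. -/
theorem card_rootSet_of_irreducible {c : F[X]} (hc : Irreducible c) (h1 : c.coeff 0 = 1)
    (hdeg : c.natDegree = finrank F K) : Fintype.card (c.rootSet K) = c.natDegree := by
  have := Fact.mk hc
  refine card_rootSet_eq_natDegree (PerfectField.separable_of_irreducible hc) ?_
  have hf : finrank F (AdjoinRoot c) = c.natDegree := by
    rw [(AdjoinRoot.powerBasis hc.ne_zero).finrank]
    rfl
  have : FiniteDimensional F (AdjoinRoot c) := (AdjoinRoot.powerBasis hc.ne_zero).finite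
  have : Finite (AdjoinRoot c) := Module.finite_of_finite F
  obtain ⟨f⟩ := FiniteField.nonempty_algHom_of_finrank_dvd (F := F) (K := AdjoinRoot c) (L := K)
    (hf.trans hdeg).dvd
  have hroot : aeval (f (AdjoinRoot.root c)) c = 0 := AdjoinRoot.aeval_algHom_eq_zero c f
  rw [← (unitMinpoly_eq_iff hc h1).2 hroot, unitMinpoly, Polynomial.map_mul, map_C]
  exact (Normal.splits (F := F) inferInstance _).C_mul _

theorem mul_ncard_feedbackPoly (F : Type*) [Field F] [Fintype F] {k : ℕ} (hk : 0 < k) :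
    {c : F[X] | IsFeedbackPoly k c}.Finite ∧
    k * {c : F[X] | IsFeedbackPoly k c}.ncard = Nat.totient (Fintype.card F ^ k - 1) := by
  classical
  obtain ⟨K, _, _, _, rfl⟩ := exists_extension F hk
  have h2 : 1 < Fintype.card K := Fintype.one_lt_card
  have hcard := Module.card_eq_pow_finrank (K := F) (V := K)
  obtain ⟨ζ, hζ⟩ : ∃ ζ : K, IsPrimitiveRoot ζ (Fintype.card K - 1) := by
    obtain ⟨g, hg⟩ := IsCyclic.exists_ofOrder_eq_natCard (α := Kˣ)
    rw [Nat.card_eq_fintype_card, Fintype.card_units, ← orderOf_units] at hg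
    exact ⟨g, hg ▸ IsPrimitiveRoot.orderOf _⟩
  let G := primitiveRoots (Fintype.card K - 1) K
  have hG : ∀ x, x ∈ G ↔ orderOf x = Fintype.card K - 1 := fun x => by
    rw [mem_primitiveRoots (by omega), IsPrimitiveRoot.iff_orderOf]
  have hG0 : ∀ x ∈ G, x ≠ 0 := fun x hx => ((mem_primitiveRoots (by omega)).1 hx).ne_zero (by omega)
  have hroot : ∀ c : F[X], IsFeedbackPoly (finrank F K) c → ∀ x : K, aeval x c = 0 → x ∈ G :=
    fun c hc x hx => by
      rw [hG, orderOf_root_of_aeval_eq_zero hc.1.1 hx, hc.1.2, hc.2.1, hcard]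
  have himg : {c : F[X] | IsFeedbackPoly (finrank F K) c} = G.image (unitMinpoly F) := by
    ext c
    simp only [Set.mem_ofPred_eq, Finset.coe_image, Set.mem_image, Finset.mem_coe]
    constructor
    · intro hc
      have hpos : 0 < Fintype.card (c.rootSet K) := by
        rw [card_rootSet_of_irreducible hc.1.1 hc.2.2 hc.2.1, hc.2.1]
        exact hk
      obtain ⟨x, hx⟩ := Fintype.card_pos_iff.1 hpos
      have hx := (mem_rootSet.1 hx).2
      exact ⟨x, hroot c hc x hx, (unitMinpoly_eq_iff hc.1.1 hc.2.2).2 hx⟩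
    · rintro ⟨x, hx, rfl⟩
      exact unitMinpoly_isFeedbackPoly (hG0 x hx) ((hG x).1 hx)
  refine ⟨himg ▸ Finset.finite_toSet _, ?_⟩
  rw [himg, Set.ncard_coe_finset, ← hcard, ← hζ.card_primitiveRoots, mul_comm,
    -- The generators are counted by the fibres of `unitMinpoly`; the fibre over `c` is its set of
    -- `k` roots.
    ← smul_eq_mul, Finset.card_eq_sum_card_image (unitMinpoly F) G]
  refine (Finset.sum_const_nat fun c hc => ?_).symm
  rw [← Finset.mem_coe, ← himg] at hc
  have hfib : {x ∈ G | unitMinpoly F x = c} = (c.rootSet K).toFinset := by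
    ext x
    simp only [Finset.mem_filter, Set.mem_toFinset, mem_rootSet, unitMinpoly_eq_iff hc.1.1 hc.2.2]
    exact ⟨fun h => ⟨hc.1.1.ne_zero, h.2⟩, fun h => ⟨hroot c hc x h.2, h.2⟩⟩
  rw [hfib, Set.toFinset_card, card_rootSet_of_irreducible hc.1.1 hc.2.2 hc.2.1, hc.2.1]

end

end ConstrainedDeBruijn

/-! ### m-sequences as cycles and as zero-aligned words. -/

namespace ConstrainedDeBruijn

open Polynomial

theorem rotate_ofFn_of_periodic {α : Type*} {N : ℕ} {v : ℕ → α} (hv : ∀ n, v (n + N) = v n)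
    (m : ℕ) : (List.ofFn fun i : Fin N => v i).rotate m = List.ofFn fun i : Fin N => v (i + m) := by
  have hmod : ∀ n, v (n % N) = v n := Function.Periodic.map_mod_nat hv
  refine List.ext_getElem (by simp) fun i h1 h2 => ?_
  simp [List.getElem_rotate, hmod]

section

variable {F : Type*} [Field F] [Fintype F] {k : ℕ} {c : F[X]} {v : ℕ → F}

variable (F) in
theorem lt_card_pow (k : ℕ) : k < Fintype.card F ^ k :=
  Nat.lt_pow_self Fintype.one_lt_card

/-- `v` is a nonzero solution of the recurrence of the feedback polynomial `c`, shifted so that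
its first period ends with `k - 1` zeros. -/
structure IsAlignedSolution (k : ℕ) (c : F[X]) (v : ℕ → F) : Prop where
  poly : IsFeedbackPoly k c
  sol : (lfsr k c).IsSolution v
  ne_zero : v ≠ 0
  zeros : ∀ i < k - 1, v (Fintype.card F ^ k - 1 - (k - 1) + i) = 0

theorem shift_ne_zero (hc : IsFeedbackPoly k c) (hv : (lfsr k c).IsSolution v) (hv0 : v ≠ 0)
    (m : ℕ) : (fun n => v (n + m)) ≠ 0 := by
  intro h
  obtain ⟨i, -, hi⟩ := solution_window_ne_zero hc hv hv0 m
  exact hi (by simpa [add_comm] using congr_fun h i)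

theorem IsAlignedSolution.periodic (h : IsAlignedSolution k c v) (n : ℕ) :
    v (n + (Fintype.card F ^ k - 1)) = v n :=
  solution_periodic h.poly h.sol h.ne_zero n

/-- Otherwise the final `k - 1` zeros and the next letter `v N = v 0` would form a zero window of
length `k`. -/
theorem IsAlignedSolution.apply_zero_ne_zero (hk : 0 < k) (h : IsAlignedSolution k c v) :
    v 0 ≠ 0 := by
  intro h0
  have hN := lt_card_pow F k
  obtain ⟨i, hi, hne⟩ := solution_window_ne_zero h.poly h.sol h.ne_zero
    (Fintype.card F ^ k - 1 - (k - 1))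
  rcases lt_or_ge i (k - 1) with hi' | hi'
  · exact hne (h.zeros i hi')
  · obtain rfl : i = k - 1 := by omega
    rw [Nat.sub_add_cancel (by omega), ← zero_add (Fintype.card F ^ k - 1), h.periodic] at hne
    exact hne h0

theorem exists_isAlignedSolution {r : Cycle F → List F} (hr : IsZeroAligned k r) {s : Cycle F}
    (hs : s ∈ mSequences F k) :
    ∃ c v, IsAlignedSolution k c v ∧ r s = List.ofFn fun i : Fin (Fintype.card F ^ k - 1) => v i := by
  obtain ⟨h1, h2⟩ := hr s hs
  obtain ⟨c, u, hc, hdeg, h0, hu, hu0, rfl⟩ := hs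
  have hc : IsFeedbackPoly k c := ⟨hc, hdeg, h0⟩
  obtain ⟨m, hm⟩ := (Cycle.coe_eq_coe.1 h1).symm
  rw [rotate_ofFn_of_periodic (solution_periodic hc hu hu0)] at hm
  refine ⟨c, fun n => u (n + m), ⟨hc, lfsr_isSolution_shift hu m, shift_ne_zero hc hu hu0 m, ?_⟩,
    hm.symm⟩
  intro i hi
  rw [← hm] at h2
  obtain ⟨t, ht⟩ := h2
  have hlen := congr_arg List.length ht
  simp only [List.length_append, List.length_replicate, List.length_ofFn] at hlen
  have hti : Fintype.card F ^ k - 1 - (k - 1) = t.length := by omega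
  have := congr_arg (fun l => l[t.length + i]?) ht
  rw [hti]
  simp only [List.getElem?_append_right (Nat.le_add_right _ _), Nat.add_sub_cancel_left,
    List.getElem?_replicate, hi, if_true] at this
  rw [List.getElem?_eq_getElem (by simp; omega)] at this
  simpa using this.symm

theorem exists_isZeroAligned (hk : 0 < k) : ∃ r : Cycle F → List F, IsZeroAligned k r := by
  have h : ∀ s : Cycle F, ∃ l : List F, s ∈ mSequences F k →
      (l : Cycle F) = s ∧ List.replicate (k - 1) (0 : F) <:+ l := by
    intro s
    by_cases hs : s ∈ mSequences F k
    swap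
    · exact ⟨[], fun h => absurd h hs⟩
    obtain ⟨c, u, hc, hdeg, h0, hu, hu0, rfl⟩ := hs
    have hc : IsFeedbackPoly k c := ⟨hc, hdeg, h0⟩
    obtain ⟨m, hm⟩ := solution_exists_zero_run hc hu hu0 hk
    have hper := solution_periodic hc hu hu0
    have hN := lt_card_pow F k
    -- Rotating by `m + (k - 1)` moves the zero run starting at `m` to the end of the word.
    refine ⟨_, fun _ => ⟨Cycle.coe_eq_coe.2 (List.IsRotated.forall _ (m + (k - 1))), ?_⟩⟩
    rw [rotate_ofFn_of_periodic hper, List.suffix_iff_eq_drop]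
    refine List.ext_getElem (by simp; omega) fun i h1 h2 => ?_
    rw [List.length_replicate] at h1
    simp only [List.getElem_replicate, List.getElem_drop, List.getElem_ofFn, List.length_ofFn,
      List.length_replicate]
    rw [show Fintype.card F ^ k - 1 - (k - 1) + i + (m + (k - 1)) =
      m + i + (Fintype.card F ^ k - 1) by omega, hper, hm i h1]
  choose r hr using h
  exact ⟨r, hr⟩

/-- Two m-sequences with the same feedback polynomial are equal as cycles. -/
theorem coe_ofFn_eq_coe_ofFn {u : ℕ → F} (hc : IsFeedbackPoly k c)
    (hv : (lfsr k c).IsSolution v) (hv0 : v ≠ 0) (hu : (lfsr k c).IsSolution u) (hu0 : u ≠ 0) :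
    ((List.ofFn fun i : Fin (Fintype.card F ^ k - 1) => v i : List F) : Cycle F) =
      (List.ofFn fun i : Fin (Fintype.card F ^ k - 1) => u i : List F) := by
  obtain ⟨m, hm⟩ := solution_unique_up_to_shift hc hv hv0 hu hu0
  rw [Cycle.coe_eq_coe]
  exact ⟨m, by rw [rotate_ofFn_of_periodic (solution_periodic hc hv hv0)]; simp only [hm]⟩

theorem feedbackPoly_eq_of_coe_ofFn_eq {c' : F[X]} {u : ℕ → F}
    (hc : IsFeedbackPoly k c) (hv : (lfsr k c).IsSolution v) (hv0 : v ≠ 0)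
    (hc' : IsFeedbackPoly k c') (hu : (lfsr k c').IsSolution u) (hu0 : u ≠ 0)
    (h : ((List.ofFn fun i : Fin (Fintype.card F ^ k - 1) => v i : List F) : Cycle F) =
      (List.ofFn fun i : Fin (Fintype.card F ^ k - 1) => u i : List F)) : c = c' := by
  obtain ⟨m, hm⟩ := Cycle.coe_eq_coe.1 h
  have hpv := solution_periodic hc hv hv0
  have hpu := solution_periodic hc' hu hu0
  rw [rotate_ofFn_of_periodic hpv, List.ofFn_inj] at hm
  have hN := lt_card_pow F k
  refine feedbackPoly_unique hc hv hv0 hc' hu (m := m) (n := 0) fun i _ => ?_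
  have h1 := congr_fun hm ⟨i % (Fintype.card F ^ k - 1), Nat.mod_lt _ (by omega)⟩
  have hpv' : Function.Periodic (fun n => v (n + m)) (Fintype.card F ^ k - 1) := fun n => by
    simp only [add_right_comm n _ m, hpv]
  have h2 := hpv'.map_mod_nat i
  have h3 := Function.Periodic.map_mod_nat hpu i
  simp only at h1 h2
  rw [add_comm m, zero_add, ← h2, h1, h3]

theorem ncard_mSequences (hk : 0 < k) :
    (mSequences F k).Finite ∧
      k * (mSequences F k).ncard = Nat.totient (Fintype.card F ^ k - 1) := by
  choose f hf hf0 using fun c : F[X] => lfsr_exists_solution hk c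
  let g : F[X] → Cycle F := fun c =>
    (List.ofFn fun i : Fin (Fintype.card F ^ k - 1) => f c i : List F)
  have himg : mSequences F k = g '' {c | IsFeedbackPoly k c} := by
    ext s
    constructor
    · rintro ⟨c, u, hc, hdeg, h0, hu, hu0, rfl⟩
      exact ⟨c, ⟨hc, hdeg, h0⟩, coe_ofFn_eq_coe_ofFn ⟨hc, hdeg, h0⟩ (hf c) (hf0 c) hu hu0⟩
    · rintro ⟨c, ⟨hc, hdeg, h0⟩, rfl⟩
      exact ⟨c, f c, hc, hdeg, h0, hf c, hf0 c, rfl⟩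
  have hinj : Set.InjOn g {c | IsFeedbackPoly k c} := fun c hc c' hc' h =>
    feedbackPoly_eq_of_coe_ofFn_eq hc (hf c) (hf0 c) hc' (hf c') (hf0 c') h
  obtain ⟨hfin, hcard⟩ := mul_ncard_feedbackPoly F hk
  rw [himg, hinj.ncard_image]
  exact ⟨hfin.image g, hcard⟩

end

end ConstrainedDeBruijn

/-! ### Windows in an infinite concatenation of blocks. -/

namespace ConstrainedDeBruijn

open Polynomial

section Word

variable {F : Type*} [Field F] [Fintype F] {k : ℕ}

/-- The infinite word `W` is the concatenation of the blocks `v a 0, …, v a (N - 1)` followed by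
`ε a` zeros, where `P a` is the starting position of the block `a`. The word is preceded by
`k - 1` zeros. -/
structure IsConcatenation (k N : ℕ) (v : ℕ → ℕ → F) (ε P : ℕ → ℕ) (W : ℕ → F) : Prop where
  start_zero : P 0 = 0
  start_succ : ∀ a, P (a + 1) = P a + N + ε a
  prefix_eq : ∀ t < k - 1, W t = 0
  block_eq : ∀ a, ∀ t < N, W (P a + t + (k - 1)) = v a t
  gap_eq : ∀ a, ∀ t < ε a, W (P a + N + t + (k - 1)) = 0

variable {c : ℕ → F[X]} {v : ℕ → ℕ → F} {ε P : ℕ → ℕ} {W : ℕ → F}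

/-- The last `k - 1` zeros of the block merge with the gap into one run. -/
theorem IsConcatenation.apply_gap
    (hW : IsConcatenation k (Fintype.card F ^ k - 1) v ε P W)
    (hv : ∀ a, IsAlignedSolution k (c a) (v a)) (a : ℕ) {y : ℕ} (hy : y < ε a + (k - 1)) :
    W (P a + (Fintype.card F ^ k - 1) + y) = 0 := by
  have hN := lt_card_pow F k
  rcases lt_or_ge y (k - 1) with h | h
  · have h1 := hW.block_eq a (Fintype.card F ^ k - 1 - (k - 1) + y) (by omega)
    rw [(hv a).zeros y h] at h1
    rw [← h1]
    congr 1
    omega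
  · rw [← hW.gap_eq a (y - (k - 1)) (by omega)]
    congr 1
    omega

/-- The `k - 1` letters before a block are zeros, whether they come from the prefix, a gap or the
previous block. They are also what precedes `v a` cyclically, so the stretch reads `v a` from phase
`N - (k - 1)` on. -/
theorem IsConcatenation.apply_block
    (hW : IsConcatenation k (Fintype.card F ^ k - 1) v ε P W)
    (hv : ∀ a, IsAlignedSolution k (c a) (v a)) (a : ℕ) {y : ℕ} (hy : y < Fintype.card F ^ k - 1 + (k - 1)) :
    W (P a + y) = v a (Fintype.card F ^ k - 1 - (k - 1) + y) := by
  have hN := lt_card_pow F k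
  rcases lt_or_ge y (k - 1) with h | h
  · rw [(hv a).zeros y h]
    rcases a with - | a
    · rw [hW.start_zero, zero_add, hW.prefix_eq y h]
    · rw [hW.start_succ, add_assoc, hW.apply_gap hv a (by omega)]
  · rw [show Fintype.card F ^ k - 1 - (k - 1) + y =
      y - (k - 1) + (Fintype.card F ^ k - 1) by omega, (hv a).periodic,
      ← hW.block_eq a (y - (k - 1)) (by omega)]
    congr 1
    omega

theorem IsConcatenation.exists_block
    (hW : IsConcatenation k (Fintype.card F ^ k - 1) v ε P W) (hk : 0 < k) (p : ℕ) :
    ∃ a x, p = P a + x ∧ x < Fintype.card F ^ k - 1 + ε a := by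
  have hN := lt_card_pow F k
  induction p with
  | zero => exact ⟨0, 0, by rw [hW.start_zero], by omega⟩
  | succ p ih =>
    obtain ⟨a, x, rfl, hx⟩ := ih
    rcases lt_or_ge (x + 1) (Fintype.card F ^ k - 1 + ε a) with h | h
    · exact ⟨a, x + 1, by omega, h⟩
    · exact ⟨a + 1, 0, by rw [hW.start_succ]; omega, by omega⟩

theorem IsConcatenation.exists_ne_zero
    (hW : IsConcatenation k (Fintype.card F ^ k - 1) v ε P W)
    (hv : ∀ a, IsAlignedSolution k (c a) (v a)) (a : ℕ) {x : ℕ} (hx : x < Fintype.card F ^ k - 1) :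
    ∃ i < k, W (P a + x + i) ≠ 0 := by
  obtain ⟨i, hi, h⟩ := solution_window_ne_zero (hv a).poly (hv a).sol (hv a).ne_zero
    (Fintype.card F ^ k - 1 - (k - 1) + x)
  refine ⟨i, hi, ?_⟩
  rw [add_assoc, hW.apply_block hv a (by omega), ← add_assoc]
  exact h

theorem IsConcatenation.eq_of_window_eq
    (hW : IsConcatenation k (Fintype.card F ^ k - 1) v ε P W)
    (hv : ∀ a, IsAlignedSolution k (c a) (v a)) (a : ℕ) {x y : ℕ} (hx : x < Fintype.card F ^ k - 1)
    (hy : y < Fintype.card F ^ k - 1) (h : ∀ i < k, W (P a + x + i) = W (P a + y + i)) :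
    x = y := by
  have h1 := solution_window_injective (hv a).poly (hv a).sol (hv a).ne_zero
    (m := Fintype.card F ^ k - 1 - (k - 1) + x) (n := Fintype.card F ^ k - 1 - (k - 1) + y)
    fun i hi => by
      have := h i hi
      rwa [add_assoc, hW.apply_block hv a (by omega), add_assoc (P a),
        hW.apply_block hv a (by omega), ← add_assoc, ← add_assoc] at this
  exact (Nat.ModEq.add_left_cancel' _ h1).eq_of_lt_of_lt hx hy

/-- The cases are on whether each window starts at an offset below `N`, so that its first `k`
letters do not all vanish, or in a gap. If `p'` lies beyond `P (a + 1)`, then `p' < p + N` keeps its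
offset there below `N`. -/
theorem IsConcatenation.exists_window_ne
    (hW : IsConcatenation k (Fintype.card F ^ k - 1) v ε P W)
    (hv : ∀ a, IsAlignedSolution k (c a) (v a)) (hk : 0 < k) (hε : ∀ a, ε a ≤ k + 1)
    (hc : ∀ a, c a = c (a + 1) → v a = v (a + 1)) {p p' : ℕ} (hpp' : p < p')
    (hp' : p' < p + (Fintype.card F ^ k - 1)) : ∃ t < 2 * k, W (p + t) ≠ W (p' + t) := by
  by_contra! heq
  have hN := lt_card_pow F k
  obtain ⟨a, x, rfl, hx⟩ := hW.exists_block hk p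
  have hsucc := hW.start_succ a
  have hgap : ∀ y, y < ε a + (k - 1) → ∀ z, z = P a + (Fintype.card F ^ k - 1) + y → W z = 0 :=
    fun y hy z hz => hz ▸ hW.apply_gap hv a hy
  rcases lt_or_ge x (Fintype.card F ^ k - 1) with hxN | hxN
  · rcases lt_or_ge p' (P a + (Fintype.card F ^ k - 1)) with h1 | h1
    · obtain ⟨y, rfl⟩ := Nat.exists_eq_add_of_le (show P a ≤ p' by omega)
      have := hW.eq_of_window_eq hv a hxN (by omega) fun i hi => heq i (by omega)
      omega
    rcases lt_or_ge p' (P (a + 1)) with h2 | h2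
    · obtain ⟨i, hi, hne⟩ := hW.exists_ne_zero hv a hxN
      rw [heq i (by omega)] at hne
      exact hne (hgap (p' - (P a + (Fintype.card F ^ k - 1)) + i) (by omega) _ (by omega))
    obtain ⟨y, rfl⟩ := Nat.exists_eq_add_of_le h2
    rcases lt_or_ge (x + k) (Fintype.card F ^ k - 1) with h3 | h3
    -- Since `x + k < N`, all `2 * k` letters are read from `v a`. Equal sequences would then force
    -- `x = y`, whereas `p' < p + N` gives `y < x`.
    · have hca : c a = c (a + 1) :=
        feedbackPoly_unique (hv a).poly (hv a).sol (hv a).ne_zero (hv (a + 1)).poly (hv (a + 1)).sol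
          (m := Fintype.card F ^ k - 1 - (k - 1) + x) (n := Fintype.card F ^ k - 1 - (k - 1) + y)
          fun i hi => by
            have := heq i hi
            rwa [add_assoc, hW.apply_block hv a (by omega), add_assoc (P (a + 1)),
              hW.apply_block hv (a + 1) (by omega), ← add_assoc, ← add_assoc] at this
      have hva := hc a hca
      have : x = y := hW.eq_of_window_eq hv (a + 1) (by omega) (by omega) fun i hi => by
        rw [← heq i (by omega), add_assoc, add_assoc, hW.apply_block hv a (by omega),
          hW.apply_block hv (a + 1) (by omega), hva]
      omega
    · -- the first window runs into the gap after block `a`, or directly into block `a + 1`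
      have hyN : y + (Fintype.card F ^ k - 1 - x) < Fintype.card F ^ k - 1 := by omega
      -- Skipping `N - x ≤ k` letters brings the first window to `P a + N` and leaves at least `k`
      -- letters to compare.
      rcases Nat.eq_zero_or_pos (ε a) with h0 | h0
      · have := hW.eq_of_window_eq hv (a + 1) (x := 0) (by omega) hyN fun i hi => by
          have := heq (Fintype.card F ^ k - 1 - x + i) (by omega)
          convert this using 2 <;> omega
        omega
      · obtain ⟨i, hi, hne⟩ := hW.exists_ne_zero hv (a + 1) hyN
        have h4 := heq (Fintype.card F ^ k - 1 - x + i) (by omega)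
        rw [hgap i (by omega) _ (by omega)] at h4
        apply hne
        rw [h4]
        congr 1
        omega
  · rcases lt_or_ge p' (P (a + 1)) with h2 | h2
    · obtain ⟨i, hi, hne⟩ := hW.exists_ne_zero hv (a + 1) (x := 0) (by omega)
      -- Here `P (a + 1) - p' ≤ ε a - 1 ≤ k`, so the nonzero letter has index below `2 * k` in the
      -- second window. In the first window that index lies at least one place earlier, still in the
      -- zero run.
      have hεa := hε a
      have h4 := heq (P (a + 1) - p' + i) (by omega)
      rw [hgap (x + (P (a + 1) - p') + i - (Fintype.card F ^ k - 1)) (by omega) _ (by omega)] at h4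
      apply hne
      rw [h4]
      congr 1
      omega
    · obtain ⟨y, rfl⟩ := Nat.exists_eq_add_of_le h2
      obtain ⟨i, hi, hne⟩ := hW.exists_ne_zero hv (a + 1) (x := y) (by omega)
      rw [← heq i (by omega)] at hne
      exact hne (hgap (x - (Fintype.card F ^ k - 1) + i) (by omega) _ (by omega))

end Word

end ConstrainedDeBruijn

/-! ### Finite concatenations. -/

namespace ConstrainedDeBruijn

open Polynomial

section Concat

variable {α : Type*}

/-- The concatenation of the words `B 0, …, B (n - 1)`. -/
def concat (B : ℕ → List α) (n : ℕ) : List α :=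
  ((List.range n).map B).flatten

theorem concat_succ (B : ℕ → List α) (n : ℕ) : concat B (n + 1) = concat B n ++ B n := by
  simp [concat, List.range_succ]

theorem concat_prefix_of_le (B : ℕ → List α) {m n : ℕ} (h : m ≤ n) : concat B m <+: concat B n := by
  induction n, h using Nat.le_induction with
  | base => exact List.prefix_rfl
  | succ n _ ih => exact ih.trans (concat_succ B n ▸ List.prefix_append _ _)

theorem concat_getElem?_eq (B : ℕ → List α) {m n i : ℕ} (hm : i < (concat B m).length)
    (hn : i < (concat B n).length) : (concat B m)[i]? = (concat B n)[i]? := by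
  rcases le_total m n with h | h
  · exact (List.prefix_iff_getElem?.1 (concat_prefix_of_le B h) i hm).symm ▸ List.getElem?_eq_getElem hm
  · exact (List.prefix_iff_getElem?.1 (concat_prefix_of_le B h) i hn) ▸
      (List.getElem?_eq_getElem hn).symm

theorem le_length_concat {B : ℕ → List α} (hB : ∀ a, 0 < (B a).length) (n : ℕ) :
    n ≤ (concat B n).length := by
  induction n with
  | zero => exact Nat.zero_le _
  | succ n ih =>
    rw [concat_succ, List.length_append]
    have := hB n
    omega

theorem concat_getElem?_block (B : ℕ → List α) (a : ℕ) {t n : ℕ} (ht : t < (B a).length)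
    (hn : (concat B a).length + t < (concat B n).length) :
    (concat B n)[(concat B a).length + t]? = (B a)[t]? := by
  rw [concat_getElem?_eq B hn (n := a + 1) (by rw [concat_succ, List.length_append]; omega),
    concat_succ, List.getElem?_append_right (Nat.le_add_right _ _), Nat.add_sub_cancel_left]

theorem flatten_ofFn_eq_concat (B : ℕ → List α) (n : ℕ) :
    (List.ofFn fun i : Fin n => B i).flatten = concat B n := by
  rw [concat, ← List.map_coe_finRange_eq_range, List.map_map, List.ofFn_eq_map]
  rfl

theorem replicate_append_inj {x : α} {m n : ℕ} {l l' : List α} (hl : l.head? ≠ some x)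
    (hl' : l'.head? ≠ some x) (h : List.replicate m x ++ l = List.replicate n x ++ l') :
    m = n ∧ l = l' := by
  induction m generalizing n with
  | zero =>
    cases n with
    | zero => simpa using h
    | succ n => simp_all [List.replicate_succ]
  | succ m ih =>
    cases n with
    | zero =>
      exfalso
      apply hl'
      rw [List.replicate_zero, List.nil_append] at h
      rw [← h]
      rfl
    | succ n =>
      simp only [List.replicate_succ, List.cons_append, List.cons.injEq, true_and] at h
      obtain ⟨rfl, rfl⟩ := ih h
      exact ⟨rfl, rfl⟩

end Concat

/-! ### The code: window property, lengths and cardinality. -/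

section Code

variable {F : Type*} [Field F] [Fintype F] {k : ℕ} {r : Cycle F → List F}

theorem IsZeroAligned.length_eq (hr : IsZeroAligned k r) {s : Cycle F} (hs : s ∈ mSequences F k) :
    (r s).length = Fintype.card F ^ k - 1 := by
  obtain ⟨c, v, -, h⟩ := exists_isAlignedSolution hr hs
  rw [h, List.length_ofFn]

theorem IsZeroAligned.head?_ne (hr : IsZeroAligned k r) (hk : 0 < k) {s : Cycle F}
    (hs : s ∈ mSequences F k) (l : List F) : (r s ++ l).head? ≠ some 0 := by
  obtain ⟨c, v, hv, h⟩ := exists_isAlignedSolution hr hs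
  have hN := lt_card_pow F k
  have h0 := hv.apply_zero_ne_zero hk
  obtain ⟨N, hN'⟩ : ∃ N, Fintype.card F ^ k - 1 = N + 1 := ⟨Fintype.card F ^ k - 2, by omega⟩
  rw [h, hN', List.ofFn_succ]
  simpa using h0

theorem IsZeroAligned.injOn (hr : IsZeroAligned k r) : Set.InjOn r (mSequences F k) :=
  fun s hs s' hs' h => by rw [← (hr s hs).1, h, (hr s' hs').1]

/-- Repeating the blocks periodically yields a family indexed by all naturals, so the last block
needs no special treatment. At least one block is required, hence `ℓ + 1`. -/
theorem exists_concat_of_mem_code {ℓ : ℕ} {w : List F} (hw : w ∈ code k (ℓ + 1) r) :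
    ∃ (s : ℕ → Cycle F) (ε : ℕ → ℕ), (∀ a, s a ∈ mSequences F k) ∧ (∀ a, ε a ≤ k + 1) ∧
      w = concat (fun a => r (s a) ++ List.replicate (ε a) 0) (ℓ + 1) := by
  obtain ⟨s, ε, hs, hε, rfl⟩ := hw
  refine ⟨fun a => s (Fin.ofNat (ℓ + 1) a), fun a => ε (Fin.ofNat (ℓ + 1) a), fun a => hs _,
    fun a => hε _, ?_⟩
  rw [← flatten_ofFn_eq_concat]
  simp

theorem isConstrainedDeBruijn_concat (hk : 0 < k) (hr : IsZeroAligned k r) {s : ℕ → Cycle F}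
    {ε : ℕ → ℕ} (hs : ∀ a, s a ∈ mSequences F k) (hε : ∀ a, ε a ≤ k + 1) (n : ℕ) :
    IsConstrainedDeBruijn (Fintype.card F ^ k - 1) (2 * k)
      (concat (fun a => r (s a) ++ List.replicate (ε a) 0) n) := by
  have hN := lt_card_pow F k
  choose c v hv hrv using fun a => exists_isAlignedSolution hr (hs a)
  set B : ℕ → List F := fun a => r (s a) ++ List.replicate (ε a) 0
  have hBlen : ∀ a, (B a).length = Fintype.card F ^ k - 1 + ε a := fun a => by
    simp [B, hr.length_eq (hs a)]
  have hle : ∀ n, n ≤ (concat B n).length :=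
    le_length_concat fun a => by rw [hBlen]; omega
  let P : ℕ → ℕ := fun a => (concat B a).length
  -- `concat B (t + 1)` has length at least `t + 1`, so the default value `0` is never used.
  let W : ℕ → F := fun t =>
    if t < k - 1 then 0 else ((concat B (t + 1))[t - (k - 1)]?).getD 0
  have hWi : ∀ n i, i < (concat B n).length → W (i + (k - 1)) = ((concat B n)[i]?).getD 0 := by
    intro n i hi
    have h1 := hle (i + (k - 1) + 1)
    simp only [W, if_neg (show ¬ i + (k - 1) < k - 1 by omega), Nat.add_sub_cancel]
    rw [concat_getElem?_eq B (by omega) hi]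
  have hWB : ∀ a t, t < (B a).length → W (P a + t + (k - 1)) = ((B a)[t]?).getD 0 := by
    intro a t ht
    have hlt : (concat B a).length + t < (concat B (a + 1)).length := by
      rw [concat_succ, List.length_append]
      omega
    rw [hWi (a + 1) _ hlt, concat_getElem?_block B a ht hlt]
  have hW : IsConcatenation k (Fintype.card F ^ k - 1) v ε P W :=
    { start_zero := rfl
      start_succ := fun a => by
        simp only [P]
        rw [concat_succ, List.length_append, hBlen, add_assoc]
      prefix_eq := fun t ht => if_pos ht
      block_eq := fun a t ht => by
        rw [hWB a t (by rw [hBlen]; omega)]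
        simp [B, hrv, List.getElem?_append_left, ht]
      gap_eq := fun a t ht => by
        rw [add_assoc (P a), hWB a _ (by rw [hBlen]; omega)]
        simp [B, hr.length_eq (hs a), ht] }
  -- One word is fixed per m-sequence: equal polynomials give equal cycles, hence equal words and,
  -- by periodicity, equal sequences.
  have hc : ∀ a, c a = c (a + 1) → v a = v (a + 1) := by
    intro a hca
    have hsa : s a = s (a + 1) := by
      have h := coe_ofFn_eq_coe_ofFn (hv a).poly (hv a).sol (hv a).ne_zero
        (hca ▸ (hv (a + 1)).sol) (hv (a + 1)).ne_zero
      rwa [← hrv, ← hrv, (hr _ (hs a)).1, (hr _ (hs (a + 1))).1] at h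
    have h := hrv a
    rw [hsa, hrv (a + 1), List.ofFn_inj] at h
    funext i
    have hi := congr_fun h ⟨i % (Fintype.card F ^ k - 1), Nat.mod_lt _ (by omega)⟩
    have h1 := Function.Periodic.map_mod_nat (hv a).periodic i
    have h2 := Function.Periodic.map_mod_nat (hv (a + 1)).periodic i
    rw [← h1, ← h2]
    exact hi.symm
  intro i j hij hji hj heq
  obtain ⟨t, ht, hne⟩ := hW.exists_window_ne hv hk hε hc (p := i + (k - 1)) (p' := j + (k - 1))
    (by omega) (by omega)
  apply hne
  rw [add_right_comm i, add_right_comm j, hWi n _ (by omega), hWi n _ (by omega)]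
  have := congr_arg (fun l => l[t]?) heq
  simp only [List.getElem?_take, ht, if_true, List.getElem?_drop] at this
  rw [this]

theorem length_concat_bounds (hr : IsZeroAligned k r) {s : ℕ → Cycle F} {ε : ℕ → ℕ}
    (hs : ∀ a, s a ∈ mSequences F k) (hε : ∀ a, ε a ≤ k + 1) (n : ℕ) :
    n * (Fintype.card F ^ k - 1) ≤
        (concat (fun a => r (s a) ++ List.replicate (ε a) 0) n).length ∧
      (concat (fun a => r (s a) ++ List.replicate (ε a) 0) n).length ≤
        n * (Fintype.card F ^ k + k) := by
  induction n with
  | zero => simp [concat]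
  | succ n ih =>
    have hN := lt_card_pow F k
    have := hε n
    rw [concat_succ, List.length_append, List.length_append, List.length_replicate,
      hr.length_eq (hs n), add_mul, add_mul]
    omega

/-- The word with prescribed blocks determines the blocks. -/
theorem flatten_blocks_injective (hk : 0 < k) (hr : IsZeroAligned k r) {ℓ : ℕ}
    {s s' : Fin ℓ → Cycle F} {ε ε' : Fin ℓ → ℕ} (hs : ∀ i, s i ∈ mSequences F k)
    (hs' : ∀ i, s' i ∈ mSequences F k)
    (h : (List.ofFn fun i => r (s i) ++ List.replicate (ε i) (0 : F)).flatten =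
      (List.ofFn fun i => r (s' i) ++ List.replicate (ε' i) (0 : F)).flatten) :
    s = s' ∧ ε = ε' := by
  have hhead : ∀ {n : ℕ} {s : Fin n → Cycle F} {ε : Fin n → ℕ}, (∀ i, s i ∈ mSequences F k) →
      ((List.ofFn fun i => r (s i) ++ List.replicate (ε i) (0 : F)).flatten).head? ≠ some 0 := by
    intro n s ε hs
    cases n with
    | zero => simp
    | succ n =>
      rw [List.ofFn_succ, List.flatten_cons, List.append_assoc]
      exact hr.head?_ne hk (hs 0) _
  induction ℓ with
  | zero => exact ⟨Subsingleton.elim _ _, Subsingleton.elim _ _⟩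
  | succ ℓ ih =>
    rw [List.ofFn_succ, List.ofFn_succ, List.flatten_cons, List.flatten_cons, List.append_assoc,
      List.append_assoc] at h
    obtain ⟨h1, h2⟩ := List.append_inj h (by rw [hr.length_eq (hs 0), hr.length_eq (hs' 0)])
    -- The zero run stops exactly where the next block begins with a nonzero letter or the word
    -- ends.
    obtain ⟨h3, h4⟩ := replicate_append_inj (hhead fun i => hs i.succ) (hhead fun i => hs' i.succ) h2
    obtain ⟨h5, h6⟩ := ih (fun i => hs i.succ) (fun i => hs' i.succ) h4
    have h7 := hr.injOn (hs 0) (hs' 0) h1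
    constructor
    · funext i
      exact Fin.cases h7 (fun i => congr_fun h5 i) i
    · funext i
      exact Fin.cases h3 (fun i => congr_fun h6 i) i

theorem finite_code_and_ncard (hk : 0 < k) (hr : IsZeroAligned k r) (ℓ : ℕ) :
    (code k ℓ r).Finite ∧ (code k ℓ r).ncard = ((mSequences F k).ncard * (k + 2)) ^ ℓ := by
  let f : (Fin ℓ → mSequences F k × Fin (k + 2)) → List F := fun x =>
    (List.ofFn fun i => r (x i).1 ++ List.replicate (x i).2 (0 : F)).flatten
  have hf : Function.Injective f := fun x y h => by
    obtain ⟨h1, h2⟩ := flatten_blocks_injective hk hr (fun i => (x i).1.2) (fun i => (y i).1.2) h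
    funext i
    exact Prod.ext (Subtype.ext (congr_fun h1 i)) (Fin.ext (congr_fun h2 i))
  have hrange : code k ℓ r = Set.range f := by
    ext w
    constructor
    · rintro ⟨s, ε, hs, hε, rfl⟩
      exact ⟨fun i => (⟨s i, hs i⟩, ⟨ε i, Nat.lt_succ_of_le (hε i)⟩), rfl⟩
    · rintro ⟨x, rfl⟩
      exact ⟨fun i => (x i).1, fun i => (x i).2, fun i => (x i).1.2,
        fun i => Nat.le_of_lt_succ (x i).2.2, rfl⟩
  have : Finite (mSequences F k) := (ncard_mSequences hk).1
  rw [hrange]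
  refine ⟨Set.finite_range f, ?_⟩
  rw [Set.ncard_range_of_injective hf, Nat.card_fun, Nat.card_prod, Nat.card_fin, Nat.card_fin,
    Nat.card_coe_set_eq]

end Code

end ConstrainedDeBruijn

/-! ### The main theorem. -/

theorem mainTheorem4 {F : Type*} [Field F] [Fintype F] (q : ℕ) (hq : Fintype.card F = q)
    (k ℓ : ℕ) (hk : 3 ≤ k) :
    (∃ r : Cycle F → List F, ConstrainedDeBruijn.IsZeroAligned k r) ∧
    ∀ r : Cycle F → List F, ConstrainedDeBruijn.IsZeroAligned k r →
      (∀ w ∈ ConstrainedDeBruijn.code k ℓ r,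
        ConstrainedDeBruijn.IsConstrainedDeBruijn (q ^ k - 1) (2 * k) w ∧
        ℓ * (q ^ k - 1) ≤ w.length ∧ w.length ≤ ℓ * (q ^ k + k)) ∧
      (ConstrainedDeBruijn.code k ℓ r).Finite ∧
      ((ConstrainedDeBruijn.code k ℓ r).ncard : ℚ) =
        ((Nat.totient (q ^ k - 1) : ℚ) * ((k : ℚ) + 2) / (k : ℚ)) ^ ℓ := by
  subst hq
  have hk0 : 0 < k := by omega
  refine ⟨ConstrainedDeBruijn.exists_isZeroAligned hk0, fun r hr => ⟨fun w hw => ?_, ?_⟩⟩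
  · cases ℓ with
    | zero =>
      obtain ⟨s, ε, -, -, rfl⟩ := hw
      refine ⟨fun i j hij _ hj => ?_, by simp, by simp⟩
      simp at hj
      omega
    | succ ℓ =>
      obtain ⟨s, ε, hs, hε, rfl⟩ := ConstrainedDeBruijn.exists_concat_of_mem_code hw
      exact ⟨ConstrainedDeBruijn.isConstrainedDeBruijn_concat hk0 hr hs hε _,
        ConstrainedDeBruijn.length_concat_bounds hr hs hε _⟩
  · obtain ⟨hfin, hcard⟩ := ConstrainedDeBruijn.finite_code_and_ncard hk0 hr ℓ
    refine ⟨hfin, ?_⟩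
    have hk' : (k : ℚ) ≠ 0 := by positivity
    rw [hcard, ← (ConstrainedDeBruijn.ncard_mSequences (F := F) hk0).2]
    push_cast
    congr 1
    field_simp
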